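/- Fix $L,M,q,s,B>0$. Let $\Omega=\{(b,d)\in\mathbb R^2: 0<b<d\le L\}$, let $\partial\Omega=\{(x,x):0\le x\le L\}$ be the diagonal segment, and let $\|\omega-\partial\Omega\|_2$ be the Euclidean distance from $\omega$ to $\partial\Omega$. A persistence measure on $\Omega$ is the counting measure $\mu=\sum_i\delta_{r_i}$ of a (possibly empty) locally finite multiset of points $r_i\in\Omega$. Let $\mathcal Z^q_{L,M}$ be the set of persistence measures $\mu$ with $\int_\Omega\|\omega-\partial\Omega\|_2^q\,d\mu(\omega)<M$, with the $\sigma$-algebra generated by the maps $\mu\mapsto\mu(A)$, $A$ Borel. For a probability distribution $P$ on $\mathcal Z^q_{L,M}$, an intensity function of $\mathbb E_P[\mu]$ is a measurable $p:\Omega\to[0,\infty)$ with $\mathbb E_P[\mu(A)]=\int_A p(u)\,du$ for all Borel $A\subseteq\Omega$. Fix an integer $r>s$ and, for $f:\Omega\to\mathbb R$, let $$\|f\|_{B^s_{\infty,\infty}}=\sup_{x\in\Omega}|f(x)|+\sup_{t>0}t^{-s}\sup\bigl\{|\Delta_h^rf(x)|:\ \|h\|_2\le t,\ x,x+h,\dots,x+rh\in\Omega\bigr\},$$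 where $\Delta_h^rf(x)=\sum_{k=0}^r(-1)^{r-k}\binom rk f(x+kh)$. Let $\mathscr F=\{f:\Omega\to\mathbb R:\ \|f\|_{B^s_{\infty,\infty}}\le B\}$. **Theorem.** There is a constant $C>0$, depending only on $L,M,q,s,B$ and $r$, such that for every $n\ge1$ $$\inf_{\hat p_n}\ \sup_{P}\ \mathbb E_{\mu_1,\dots,\mu_n\overset{\text{i.i.d.}}{\sim}P}\ \sup_{\omega\in\Omega}\|\omega-\partial\Omega\|_2^q\,\bigl|\hat p_n(\omega)-p(\omega)\bigr|\ \ge\ C\,n^{-\frac{s}{2(s+1)}}.$$ Here the infimum is over all estimators $\hat p_n$, that is, maps $(\mu_1,\dots,\mu_n)\mapsto\hat p_n\in\mathscr F$ on $(\mathcal Z^q_{L,M})^n$ such that $(\mu_1,\dots,\mu_n)\mapsto\hat p_n(\omega)$ is measurable for each $\omega\in\Omega$; the supremum is over all probability distributions $P$ on $\mathcal Z^q_{L,M}$ for which $\mathbb E_P[\mu]$ has an intensity function $p\in\mathscr F$. In particular, the same lower bound holds if the supremum is taken over all $P$ on $\mathcal Z^q_{L,M}$ for which $\mathbb E_P[\mu]$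 has an intensity function. -/

import Mathlib

open MeasureTheory
open scoped ENNReal Topology

noncomputable section

namespace PersistenceMinimax

/-- The Euclidean plane; a point `x` has birth `x 0` and death `x 1`. -/
abbrev Plane : Type := EuclideanSpace ℝ (Fin 2)

/-- `Ω = {(b, d) : 0 < b < d ≤ L}`. -/
def domain (L : ℝ) : Set Plane := {x | 0 < x 0 ∧ x 0 < x 1 ∧ x 1 ≤ L}

/-- `∂Ω = {(t, t) : 0 ≤ t ≤ L}`. -/
def diagonal (L : ℝ) : Set Plane := {x | x 0 = x 1 ∧ 0 ≤ x 0 ∧ x 0 ≤ L}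

/-- The Euclidean distance `‖x - ∂Ω‖₂` of a point to the diagonal segment. -/
def diagDist (L : ℝ) (x : Plane) : ℝ := Metric.infDist x (diagonal L)

/-- Persistence measures: counting measures `∑ i, δ_{r i}` of locally finite multisets
of points of `Ω` (possibly empty or infinite), here enumerated by a set of natural numbers. -/
def IsPersistenceMeasure (L : ℝ) (μ : Measure Plane) : Prop :=
  ∃ (I : Set ℕ) (r : I → Plane),
    (∀ i, r i ∈ domain L) ∧
    (∀ x ∈ domain L, ∃ U ∈ 𝓝 x, {i | r i ∈ U}.Finite) ∧
    μ = Measure.sum fun i => Measure.dirac (r i)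

/-- The `q`-th order total persistence `∫_Ω ‖ω - ∂Ω‖₂ ^ q dμ(ω)`. -/
def totalPersistence (L q : ℝ) (μ : Measure Plane) : ℝ≥0∞ :=
  ∫⁻ x in domain L, ENNReal.ofReal (diagDist L x ^ q) ∂μ

/-- The set of persistence measures on `Ω` with `q`-th order total persistence less than `M`.
As a subtype it carries the σ-algebra generated by the evaluations `μ ↦ μ A`, `A` Borel. -/
def boundedPersistence (L M q : ℝ) : Set (Measure Plane) :=
  {μ | IsPersistenceMeasure L μ ∧ totalPersistence L q μ < ENNReal.ofReal M}

/-- The `r`-th modulus of smoothness of `f` on `Ω` in the supremum norm: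
the supremum of `|Δ_h^r f (x)|` over `‖h‖ ≤ t` and all `x` whose translates
`x, x + h, …, x + r h` lie in `Ω`. -/
def smoothnessModulus (L : ℝ) (r : ℕ) (f : Plane → ℝ) (t : ℝ) : ℝ≥0∞ :=
  ⨆ (h : Plane) (_ : ‖h‖ ≤ t) (x : Plane) (_ : ∀ k : ℕ, k ≤ r → x + k • h ∈ domain L),
    ‖(fwdDiff h)^[r] f x‖ₑ

/-- The Besov norm of `f` restricted to `Ω`, for the space `B^s_{∞,∞}(Ω)`, through `r`-th order
differences (`r > s`):
`sup_Ω |f| + sup_{t > 0} t ^ (-s) ω_r(f, t)`. -/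
def besovNorm (L : ℝ) (r : ℕ) (s : ℝ) (f : Plane → ℝ) : ℝ≥0∞ :=
  (⨆ x ∈ domain L, ‖f x‖ₑ) +
    ⨆ (t : ℝ) (_ : 0 < t), ENNReal.ofReal (t ^ (-s)) * smoothnessModulus L r f t

/-- The Besov ball of radius `B`. Only the values of a function on `Ω` matter. -/
def besovBall (L : ℝ) (r : ℕ) (s B : ℝ) : Set (Plane → ℝ) :=
  {f | besovNorm L r s f ≤ ENNReal.ofReal B}

/-- `p` is an intensity function of the expected persistence measure `E_P[μ]`:
a nonnegative measurable function with `E_P[μ(A)] = ∫_A p` for all Borel `A ⊆ Ω`. -/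
def IsIntensity (L M q : ℝ) (P : ProbabilityMeasure (boundedPersistence L M q))
    (p : Plane → ℝ) : Prop :=
  Measurable p ∧ (∀ x ∈ domain L, 0 ≤ p x) ∧
    ∀ A : Set Plane, MeasurableSet A → A ⊆ domain L →
      ∫⁻ μ, (μ : Measure Plane) A ∂(P : Measure (boundedPersistence L M q)) =
        ∫⁻ x in A, ENNReal.ofReal (p x)

/-- Estimators of the intensity function from `n` observed persistence measures, with values in
the Besov ball; measurability is that of each `(μ₁, …, μₙ) ↦ p̂(ω)`, `ω ∈ Ω`. -/
def IsEstimator (L M q : ℝ) (r : ℕ) (s B : ℝ) (n : ℕ)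
    (phat : (Fin n → boundedPersistence L M q) → Plane → ℝ) : Prop :=
  (∀ D, phat D ∈ besovBall L r s B) ∧ ∀ ω ∈ domain L, Measurable fun D => phat D ω

/-- The loss `sup_{ω ∈ Ω} ‖ω - ∂Ω‖₂ ^ q |f ω - p ω|`. -/
def weightedLoss (L q : ℝ) (f p : Plane → ℝ) : ℝ≥0∞ :=
  ⨆ ω ∈ domain L, ENNReal.ofReal (diagDist L ω ^ q * |f ω - p ω|)

/-- The risk of `phat` for `n` i.i.d. observations with distribution `P`, where the target
is `p`. -/
def risk (L M q : ℝ) (n : ℕ) (phat : (Fin n → boundedPersistence L M q) → Plane → ℝ)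
    (P : ProbabilityMeasure (boundedPersistence L M q)) (p : Plane → ℝ) : ℝ≥0∞ :=
  ∫⁻ D, weightedLoss L q (phat D) p
    ∂(Measure.pi fun _ : Fin n => (P : Measure (boundedPersistence L M q)))

/-- The minimax risk: infimum over estimators of the supremum over the probability distributions
`P` whose expected persistence measure has an intensity function `p` in the Besov ball. -/
def minimaxRisk (L M q : ℝ) (r : ℕ) (s B : ℝ) (n : ℕ) : ℝ≥0∞ :=
  ⨅ (phat : (Fin n → boundedPersistence L M q) → Plane → ℝ)
    (_ : IsEstimator L M q r s B n phat),
  ⨆ (P : ProbabilityMeasure (boundedPersistence L M q)) (p : Plane → ℝ)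
    (_ : IsIntensity L M q P p) (_ : p ∈ besovBall L r s B),
    risk L M q n phat P p

end PersistenceMinimax

end

/-! Le Cam's two-point method with diagrams of at most one point. Under the first law a point of a
small ball in `Ω` is drawn with subprobability density `p = c * b`, the leftover mass going to the
empty diagram; under the second the density is `p * (1 + ε * u)`, where `u` is a mean-zero bump of
width `h` around `x₀`, supported where `p = c`. Besov smoothness allows `ε` of order `h ^ s`. In the
plane `∫ u ^ 2` is of order `h ^ 2`, so the likelihood ratio has second moment `1 + O(h ^ (2 * s +
2))`. For `h` of order `n ^ (-1 / (2 * (s + 1)))` this is at most `1 + 1 / n`, and `n` samples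
cannot separate the laws. The intensities differ at `x₀` by `c * ε`, of order `n ^ (-s / (2 * (s +
1)))`, and the weight at `x₀` is a positive constant. `two_point_lower_bound` is the testing step,
`two_point_le_minimaxRisk` carries it over to diagrams, and `lintegral_perturbation` computes the
moments. -/

namespace PersistenceMinimax

/-! ### Le Cam's bound for product measures -/

section TwoPoint

variable {X : Type*} [MeasurableSpace X] {n : ℕ}

lemma lintegral_pi_prod (ν : Measure X) [IsProbabilityMeasure ν] {f : Fin n → X → ℝ≥0∞}
    (hf : ∀ i, Measurable (f i)) :
    ∫⁻ D, ∏ i, f i (D i) ∂(Measure.pi fun _ : Fin n => ν) = ∏ i, ∫⁻ x, f i x ∂ν := by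
  have hind := ProbabilityTheory.iIndepFun_pi (μ := fun _ : Fin n => ν) (X := f)
    fun i => (hf i).aemeasurable
  have h := ProbabilityTheory.lintegral_prod_eq_prod_lintegral_of_indepFun Finset.univ
    (fun i (D : Fin n → X) => f i (D i)) hind (fun i => (hf i).comp (measurable_pi_apply i))
  rw [h]
  refine Finset.prod_congr rfl fun i _ => ?_
  exact (measurePreserving_eval (fun _ : Fin n => ν) i).lintegral_comp (hf i)

lemma pi_withDensity_prod (ν : Measure X) [IsProbabilityMeasure ν] {g : X → ℝ≥0∞}
    (hg : Measurable g) (h1 : ∫⁻ x, g x ∂ν = 1) :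
    Measure.pi (fun _ : Fin n => ν.withDensity g) =
      (Measure.pi fun _ : Fin n => ν).withDensity fun D => ∏ i, g (D i) := by
  have : IsProbabilityMeasure (ν.withDensity g) := ⟨by simp [h1]⟩
  refine (Measure.pi_eq fun s hs => ?_)
  rw [withDensity_apply _ (MeasurableSet.univ_pi hs),
    ← lintegral_indicator (MeasurableSet.univ_pi hs)]
  have : ∀ D : Fin n → X, (Set.univ.pi s).indicator (fun D => ∏ i, g (D i)) D
      = ∏ i, (s i).indicator g (D i) := by
    intro D
    by_cases hD : D ∈ Set.univ.pi s
    · rw [Set.indicator_of_mem hD]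
      exact Finset.prod_congr rfl fun i _ =>
        (Set.indicator_of_mem (hD i (Set.mem_univ i)) g).symm
    · rw [Set.indicator_of_notMem hD]
      obtain ⟨i, hi⟩ : ∃ i, D i ∉ s i := by simpa using hD
      exact (Finset.prod_eq_zero (Finset.mem_univ i) (Set.indicator_of_notMem hi g)).symm
  simp_rw [this]
  rw [lintegral_pi_prod ν fun i => hg.indicator (hs i)]
  refine Finset.prod_congr rfl fun i _ => ?_
  rw [lintegral_indicator (hs i), withDensity_apply _ (hs i)]

/-- Le Cam's two-point bound: if the likelihood ratio `g` of two distributions has a second moment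
that remains bounded for `n` observations, then no estimator `θ` is close to both targets. -/
lemma two_point_lower_bound (ν : Measure X) [IsProbabilityMeasure ν] {g : X → ℝ≥0∞}
    (hg : Measurable g) (h1 : ∫⁻ x, g x ∂ν = 1) (h2 : (∫⁻ x, g x ^ 2 ∂ν) ^ n ≤ 4)
    {θ : (Fin n → X) → ℝ} (hθ : Measurable θ) (a b : ℝ) :
    ENNReal.ofReal (|a - b| / 128) ≤
      max (∫⁻ D, ENNReal.ofReal |θ D - a| ∂(Measure.pi fun _ : Fin n => ν))
        (∫⁻ D, ENNReal.ofReal |θ D - b| ∂(Measure.pi fun _ : Fin n => ν.withDensity g)) := by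
  set Q := Measure.pi fun _ : Fin n => ν
  have : IsProbabilityMeasure (ν.withDensity g) := ⟨by simp [h1]⟩
  set Q' := Measure.pi fun _ : Fin n => ν.withDensity g with hQ'
  set G : (Fin n → X) → ℝ≥0∞ := fun D => ∏ i, g (D i) with hG
  have hQG : Q' = Q.withDensity G := pi_withDensity_prod ν hg h1
  have hG2 : ∫⁻ D, G D ^ 2 ∂Q ≤ 4 := by
    simp_rw [hG, ← Finset.prod_pow]
    rw [lintegral_pi_prod ν fun _ => hg.pow_const 2]
    simpa using h2
  set A : Set (Fin n → X) := {D | |a - b| / 2 ≤ |θ D - a|} with hAdef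
  have hA : MeasurableSet A := measurableSet_le measurable_const (by fun_prop)
  -- Truncating the likelihood ratio at 16: always `G ≤ 16 + G ^ 2 / 16`, and the second moment 4
  -- leaves the error `4 / 16`.
  have hQ'A : Q' A ≤ 16 * Q A + 1 / 4 := by
    rw [hQG, withDensity_apply _ hA]
    calc ∫⁻ D in A, G D ∂Q ≤ ∫⁻ D in A, (16 + G D ^ 2 / 16) ∂Q := by
          refine lintegral_mono fun D => ?_
          rcases le_total (G D) 16 with h | h
          · exact h.trans le_self_add
          · refine le_trans ?_ le_add_self
            rw [ENNReal.le_div_iff_mul_le (by simp) (by simp), sq]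
            gcongr
      _ = 16 * Q A + ∫⁻ D in A, G D ^ 2 / 16 ∂Q := by
          rw [lintegral_add_left measurable_const]; simp
      _ ≤ 16 * Q A + 4 / 16 := by
          gcongr
          simp_rw [div_eq_mul_inv]
          rw [lintegral_mul_const' _ _ (by simp)]
          gcongr
          exact (setLIntegral_le_lintegral _ _).trans hG2
      _ = _ := by
          congr 1
          rw [show (16 : ℝ≥0∞) = 4 * 4 by norm_num,
            ← ENNReal.mul_div_mul_left 1 4 (c := 4) (by simp) (by simp)]
          simp
  have hR0 : ENNReal.ofReal (|a - b| / 2) * Q A ≤ ∫⁻ D, ENNReal.ofReal |θ D - a| ∂Q := by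
    rw [← setLIntegral_const]
    refine (setLIntegral_mono' hA fun D hD => ?_).trans (setLIntegral_le_lintegral A _)
    exact ENNReal.ofReal_le_ofReal hD
  have hR1 : ENNReal.ofReal (|a - b| / 2) * Q' Aᶜ ≤ ∫⁻ D, ENNReal.ofReal |θ D - b| ∂Q' := by
    rw [← setLIntegral_const]
    refine (setLIntegral_mono' hA.compl fun D hD => ?_).trans (setLIntegral_le_lintegral Aᶜ _)
    refine ENNReal.ofReal_le_ofReal ?_
    have hD' : |θ D - a| < |a - b| / 2 := not_le.1 hD
    have := abs_sub_le a (θ D) b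
    rw [abs_sub_comm a (θ D)] at this
    linarith
  -- Otherwise the total mass of `Q'` would be at most `16 / 64 + 1 / 4 + 1 / 64 < 1`.
  have key : 1 / 64 ≤ max (Q A) (Q' Aᶜ) := by
    by_contra hcon
    obtain ⟨hlt0, hlt1⟩ := max_lt_iff.1 (not_le.1 hcon)
    have hsum : Q' A + Q' Aᶜ = 1 := by rw [measure_add_measure_compl hA]; simp
    have : (1 : ℝ≥0∞) < 1 := by
      calc (1 : ℝ≥0∞) = Q' A + Q' Aᶜ := hsum.symm
        _ ≤ 16 * Q A + 1 / 4 + Q' Aᶜ := by gcongr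
        _ ≤ 16 * (1 / 64) + 1 / 4 + 1 / 64 := by gcongr
        _ < 1 := by
          rw [← ENNReal.toReal_lt_toReal] <;> norm_num
          rw [ENNReal.toReal_add, ENNReal.toReal_add, ENNReal.toReal_mul] <;> norm_num
          all_goals simp [ENNReal.mul_eq_top]
    exact lt_irrefl _ this
  calc ENNReal.ofReal (|a - b| / 128) = ENNReal.ofReal (|a - b| / 2) * (1 / 64) := by
        rw [show |a - b| / 128 = |a - b| / 2 * (1 / 64) by ring,
          ENNReal.ofReal_mul (by positivity), ENNReal.ofReal_div_of_pos (by norm_num)]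
        simp
    _ ≤ ENNReal.ofReal (|a - b| / 2) * max (Q A) (Q' Aᶜ) := by gcongr
    _ ≤ _ := by
        rcases le_total (Q A) (Q' Aᶜ) with h | h
        · rw [max_eq_right h]; exact hR1.trans (le_max_right _ _)
        · rw [max_eq_left h]; exact hR0.trans (le_max_left _ _)

end TwoPoint

/-! ### Finite differences and the Besov norm -/

section Differences

lemma norm_fwdDiff_iter_le_of_bounded {E F : Type*} [AddCommMonoid E] [NormedAddCommGroup F]
    {f : E → F} {A : ℝ} (hf : ∀ x, ‖f x‖ ≤ A) (h : E) (r : ℕ) (x : E) :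
    ‖(fwdDiff h)^[r] f x‖ ≤ 2 ^ r * A := by
  induction r generalizing x with
  | zero => simpa using hf x
  | succ r ih =>
    rw [Function.iterate_succ_apply']
    calc _ ≤ ‖(fwdDiff h)^[r] f (x + h)‖ + ‖(fwdDiff h)^[r] f x‖ := norm_sub_le _ _
      _ ≤ 2 ^ r * A + 2 ^ r * A := add_le_add (ih _) (ih _)
      _ = _ := by ring

lemma hasFDerivAt_fwdDiff_iter {E F : Type*} [NormedAddCommGroup E] [NormedSpace ℝ E]
    [NormedAddCommGroup F] [NormedSpace ℝ F] {f : E → F} (hf : Differentiable ℝ f) (h : E)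
    (r : ℕ) (x : E) :
    HasFDerivAt ((fwdDiff h)^[r] f) ((fwdDiff h)^[r] (fderiv ℝ f) x) x := by
  induction r generalizing x with
  | zero => exact (hf x).hasFDerivAt
  | succ r ih =>
    rw [Function.iterate_succ_apply', Function.iterate_succ_apply']
    exact (((hasFDerivAt_comp_add_right h).2 (ih (x + h))).sub (ih x))

/-- Differencing commutes with differentiation, so induction applies to `fderiv ℝ f`, and the mean
value inequality supplies one more factor `‖h‖`. The codomain changes at each step, hence the
induction generalizes `F`. -/
lemma norm_fwdDiff_iter_le_of_contDiff {E : Type} [NormedAddCommGroup E] [NormedSpace ℝ E]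
    (r : ℕ) {F : Type} [NormedAddCommGroup F] [NormedSpace ℝ F]
    {f : E → F} (hf : ContDiff ℝ r f) {C : ℝ} (hC : ∀ x, ‖iteratedFDeriv ℝ r f x‖ ≤ C)
    (h x : E) : ‖(fwdDiff h)^[r] f x‖ ≤ C * ‖h‖ ^ r := by
  induction r generalizing F x with
  | zero => simpa using hC x
  | succ r ih =>
    have hd : ContDiff ℝ r (fderiv ℝ f) := hf.fderiv_right (by norm_cast)
    have hb := ih hd fun x => (norm_iteratedFDeriv_fderiv (𝕜 := ℝ) (f := f)).trans_le (hC x)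
    have hdiff : Differentiable ℝ f := hf.differentiable (by simp)
    rw [Function.iterate_succ_apply']
    have := convex_univ.norm_image_sub_le_of_norm_hasFDerivWithin_le (C := C * ‖h‖ ^ r)
      (fun y _ => (hasFDerivAt_fwdDiff_iter hdiff h r y).hasFDerivWithinAt)
      (fun y _ => hb y) (Set.mem_univ x) (Set.mem_univ (x + h))
    simpa [fwdDiff, pow_succ, mul_assoc] using this

/-- For `‖h‖ ≤ 1` the derivative bound suffices, since `‖h‖ ^ r ≤ ‖h‖ ^ s`; for `‖h‖ ≥ 1` the sup
bound does, since `‖h‖ ^ s ≥ 1`. -/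
lemma exists_norm_fwdDiff_iter_le_rpow {E : Type} [NormedAddCommGroup E] [NormedSpace ℝ E]
    {s : ℝ} (hs : 0 < s) {r : ℕ} (hr : s < r) {f : E → ℝ} (hf : ContDiff ℝ r f)
    (hc : HasCompactSupport f) :
    ∃ K : ℝ, 0 < K ∧ ∀ h x, |(fwdDiff h)^[r] f x| ≤ K * ‖h‖ ^ s := by
  obtain ⟨C, hC⟩ := (hf.continuous_iteratedFDeriv le_rfl).bounded_above_of_compact_support
    (hc.iteratedFDeriv r)
  obtain ⟨A, hA⟩ := hf.continuous.bounded_above_of_compact_support hc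
  refine ⟨max 1 (max C (2 ^ r * A)), by positivity, fun h x => ?_⟩
  rcases le_total ‖h‖ 1 with h1 | h1
  · refine (norm_fwdDiff_iter_le_of_contDiff r hf hC h x).trans ?_
    gcongr
    · exact (le_max_left _ _).trans (le_max_right _ _)
    · rw [← Real.rpow_natCast]
      exact Real.rpow_le_rpow_of_exponent_ge' (norm_nonneg h) h1 hs.le hr.le
  · refine (norm_fwdDiff_iter_le_of_bounded hA h r x).trans ?_
    exact ((le_max_right C _).trans (le_max_right 1 _)).trans
      (le_mul_of_one_le_right (by positivity) (Real.one_le_rpow h1 hs.le))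

lemma fwdDiff_iter_comp_smul_sub {E : Type*} [NormedAddCommGroup E] [NormedSpace ℝ E]
    (f : E → ℝ) (R : ℝ) (x₀ h : E) (r : ℕ) (x : E) :
    (fwdDiff h)^[r] (fun x => f (R • (x - x₀))) x = (fwdDiff (R • h))^[r] f (R • (x - x₀)) := by
  induction r generalizing x with
  | zero => rfl
  | succ r ih =>
    rw [Function.iterate_succ_apply', Function.iterate_succ_apply']
    simp only [fwdDiff, ih, add_sub_right_comm x h x₀, smul_add]

lemma mem_besovBall_of_bounds {L s B A K : ℝ} {r : ℕ} {f : Plane → ℝ} (hs : 0 < s)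
    (hA0 : 0 ≤ A) (hK0 : 0 ≤ K) (hA : ∀ x, |f x| ≤ A)
    (hK : ∀ h x, |(fwdDiff h)^[r] f x| ≤ K * ‖h‖ ^ s) (hB : A + K ≤ B) :
    f ∈ besovBall L r s B := by
  refine le_trans ?_ (ENNReal.ofReal_le_ofReal hB)
  rw [ENNReal.ofReal_add hA0 hK0]
  refine add_le_add (iSup₂_le fun x _ => ?_) (iSup₂_le fun t ht => ?_)
  · rw [← ofReal_norm]; exact ENNReal.ofReal_le_ofReal (hA x)
  · have : smoothnessModulus L r f t ≤ ENNReal.ofReal (K * t ^ s) := by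
      refine iSup₂_le fun h hh => iSup₂_le fun x _ => ?_
      rw [← ofReal_norm]
      refine ENNReal.ofReal_le_ofReal ((hK h x).trans ?_)
      gcongr
    calc _ ≤ ENNReal.ofReal (t ^ (-s)) * ENNReal.ofReal (K * t ^ s) := by gcongr
      _ = ENNReal.ofReal K := by
        rw [← ENNReal.ofReal_mul (by positivity)]
        congr 1
        rw [mul_left_comm, ← Real.rpow_add ht]; simp

end Differences

/-! ### One-point random diagrams and reduction to two hypotheses -/

section Model

lemma dirac_mem_boundedPersistence {L M q : ℝ} {x : Plane} (hx : x ∈ domain L)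
    (hM : diagDist L x ^ q < M) (hM0 : 0 < M) :
    Measure.dirac x ∈ boundedPersistence L M q := by
  refine ⟨⟨{0}, fun _ => x, fun _ => hx, fun _ _ => ⟨Set.univ, Filter.univ_mem, Set.toFinite _⟩,
    ?_⟩, ?_⟩
  · ext A hA
    rw [Measure.sum_apply _ hA, tsum_fintype, Fintype.sum_unique]
  · refine (setLIntegral_le_lintegral _ _).trans_lt ?_
    rw [lintegral_dirac]
    exact (ENNReal.ofReal_lt_ofReal_iff hM0).2 hM

lemma zero_mem_boundedPersistence {L M q : ℝ} (hM : 0 < M) :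
    (0 : Measure Plane) ∈ boundedPersistence L M q := by
  refine ⟨⟨∅, fun i => i.2.elim, fun i => i.2.elim,
    fun _ _ => ⟨Set.univ, Filter.univ_mem, Set.toFinite _⟩, ?_⟩, ?_⟩
  · ext A hA
    rw [Measure.sum_apply _ hA]; simp
  · simpa [totalPersistence] using hM

lemma zero_notMem_domain (L : ℝ) : (0 : Plane) ∉ domain L := fun h => lt_irrefl _ h.1

open Classical in
/-- Points of `K` as persistence measures with one point; all others give the empty measure. -/
lemma exists_measurable_dirac {L M q : ℝ} (hM : 0 < M) {K : Set Plane} (hK : MeasurableSet K)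
    (hKd : K ⊆ domain L) (hKM : ∀ x ∈ K, diagDist L x ^ q < M) :
    ∃ T : Plane → boundedPersistence L M q, Measurable T ∧
      ∀ x, (T x : Measure Plane) = if x ∈ K then Measure.dirac x else 0 := by
  have hmem : ∀ x, (if x ∈ K then Measure.dirac x else 0) ∈ boundedPersistence L M q := by
    intro x
    split_ifs with hx
    · exact dirac_mem_boundedPersistence (hKd hx) (hKM x hx) hM
    · exact zero_mem_boundedPersistence hM
  exact ⟨fun x => ⟨_, hmem x⟩,
    (Measurable.ite hK Measure.measurable_dirac measurable_const).subtype_mk, fun _ => rfl⟩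

/-- The law of a random point with subprobability density `p`, the remaining mass being put at the
origin, which lies outside of `Ω`. -/
noncomputable def baseMeasure (p : Plane → ℝ) : Measure Plane :=
  volume.withDensity (fun x => ENNReal.ofReal (p x)) +
    (1 - ∫⁻ x, ENNReal.ofReal (p x)) • Measure.dirac 0

lemma isProbabilityMeasure_baseMeasure {p : Plane → ℝ} (h : ∫⁻ x, ENNReal.ofReal (p x) ≤ 1) :
    IsProbabilityMeasure (baseMeasure p) :=
  ⟨by simp [baseMeasure, add_tsub_cancel_of_le h]⟩

lemma lintegral_baseMeasure {p : Plane → ℝ} (hp : Measurable p) {f : Plane → ℝ≥0∞}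
    (hf : Measurable f) (h0 : f 0 = 0) :
    ∫⁻ x, f x ∂(baseMeasure p) = ∫⁻ x, ENNReal.ofReal (p x) * f x := by
  rw [baseMeasure, lintegral_add_measure, lintegral_smul_measure, lintegral_dirac, h0,
    lintegral_withDensity_eq_lintegral_mul _ (by fun_prop) hf]
  simp

lemma integral_baseMeasure {p : Plane → ℝ} (hp : Measurable p) (hp0 : ∀ x, 0 ≤ p x)
    {f : Plane → ℝ} (hf : Integrable f (baseMeasure p)) (h0 : f 0 = 0) :
    ∫ x, f x ∂(baseMeasure p) = ∫ x, p x * f x := by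
  have h := integrable_add_measure.1 hf
  rw [baseMeasure, integral_add_measure h.1 h.2, integral_smul_measure, integral_dirac, h0,
    integral_withDensity_eq_integral_toReal_smul (by fun_prop) (by simp)]
  simp [hp0]

lemma isIntensity_map {L M q : ℝ} {K : Set Plane} {T : Plane → boundedPersistence L M q}
    (hT : Measurable T) (hTin : ∀ x ∈ K, (T x : Measure Plane) = Measure.dirac x)
    (hTout : ∀ x ∉ K, (T x : Measure Plane) = 0) {p g : Plane → ℝ} (hp : Measurable p)
    (hp0 : ∀ x, 0 ≤ p x) (hpK : ∀ x ∉ K, p x = 0) (hg : Measurable g) (hg0 : ∀ x, 0 ≤ g x)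
    (P : ProbabilityMeasure (boundedPersistence L M q))
    (hP : (P : Measure (boundedPersistence L M q)) =
      ((baseMeasure p).withDensity fun x => ENNReal.ofReal (g x)).map T) :
    IsIntensity L M q P fun x => p x * g x := by
  refine ⟨hp.mul hg, fun x _ => mul_nonneg (hp0 x) (hg0 x), fun A hA hAd => ?_⟩
  have hev : Measurable fun μ : boundedPersistence L M q => (μ : Measure Plane) A :=
    (Measure.measurable_coe hA).comp measurable_subtype_coe
  have hTA : Measurable fun x => (T x : Measure Plane) A := hev.comp hT
  -- The atom of `baseMeasure` at the origin adds nothing to the intensity, since the origin is not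
  -- in `A ⊆ Ω`.
  have h0 : (T 0 : Measure Plane) A = 0 := by
    by_cases h : (0 : Plane) ∈ K
    · rw [hTin 0 h, Measure.dirac_apply' _ hA]
      exact Set.indicator_of_notMem (fun h => zero_notMem_domain L (hAd h)) _
    · rw [hTout 0 h]; rfl
  rw [hP, lintegral_map hev hT, lintegral_withDensity_eq_lintegral_mul _ (by fun_prop) hTA,
    lintegral_baseMeasure hp (by fun_prop) (by simp [h0]), ← lintegral_indicator hA]
  refine lintegral_congr fun x => ?_
  simp only [Pi.mul_apply]
  by_cases hx : x ∈ K
  · rw [hTin x hx, Measure.dirac_apply' _ hA]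
    by_cases hxA : x ∈ A <;> simp [hxA, ENNReal.ofReal_mul (hp0 x)]
  · rw [hTout x hx]
    by_cases hxA : x ∈ A <;> simp [hxA, hpK x hx]

/-- The supremum in the loss is bounded below by its value at `x₀`, and the sample is pulled back
along `T`. Monotonicity of the lower integral spares any measurability of the loss. -/
lemma lintegral_pi_le_risk {L M q : ℝ} {n r : ℕ} {s B : ℝ}
    {phat : (Fin n → boundedPersistence L M q) → Plane → ℝ} (h : IsEstimator L M q r s B n phat)
    {T : Plane → boundedPersistence L M q} (hT : Measurable T) (ν : Measure Plane)
    [IsProbabilityMeasure ν] (P : ProbabilityMeasure (boundedPersistence L M q))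
    (hP : (P : Measure (boundedPersistence L M q)) = ν.map T) (p : Plane → ℝ) {x₀ : Plane}
    (hx₀ : x₀ ∈ domain L) :
    ENNReal.ofReal (diagDist L x₀ ^ q) *
      ∫⁻ D, ENNReal.ofReal |phat (fun i => T (D i)) x₀ - p x₀| ∂(Measure.pi fun _ : Fin n => ν) ≤
      risk L M q n phat P p := by
  have hm := h.2 x₀ hx₀
  have hTn : Measurable fun (D : Fin n → Plane) i => T (D i) := by fun_prop
  have : IsProbabilityMeasure (ν.map T) := Measure.isProbabilityMeasure_map hT.aemeasurable
  have hpi : (Measure.pi fun _ : Fin n => (P : Measure (boundedPersistence L M q))) =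
      (Measure.pi fun _ : Fin n => ν).map fun D i => T (D i) := by
    simp_rw [hP]
    exact (Measure.pi_map_pi fun _ => hT.aemeasurable).symm
  have hd : 0 ≤ diagDist L x₀ := Metric.infDist_nonneg
  rw [risk, ← lintegral_const_mul' _ _ (by simp), hpi]
  calc _ = ∫⁻ D, ENNReal.ofReal (diagDist L x₀ ^ q * |phat D x₀ - p x₀|)
        ∂((Measure.pi fun _ : Fin n => ν).map fun D i => T (D i)) := by
        rw [lintegral_map (by fun_prop) hTn]
        refine lintegral_congr fun D => ?_
        rw [ENNReal.ofReal_mul (by positivity)]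
    _ ≤ _ := lintegral_mono fun D => le_iSup₂_of_le x₀ hx₀ le_rfl

/-- Both laws are images under the same map `T`, so an estimator composed with `T` is a statistic of
points in the plane, where Le Cam's bound applies. -/
lemma two_point_le_minimaxRisk {L M q s B : ℝ} {r n : ℕ} (hM : 0 < M) {K : Set Plane}
    (hK : MeasurableSet K) (hKd : K ⊆ domain L) (hKM : ∀ x ∈ K, diagDist L x ^ q < M)
    {p g : Plane → ℝ} (hp : Measurable p) (hp0 : ∀ x, 0 ≤ p x) (hpK : ∀ x ∉ K, p x = 0)
    (hp1 : ∫⁻ x, ENNReal.ofReal (p x) ≤ 1) (hg : Measurable g) (hg0 : ∀ x, 0 ≤ g x)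
    (hg1 : ∫⁻ x, ENNReal.ofReal (g x) ∂(baseMeasure p) = 1)
    (hg2 : (∫⁻ x, ENNReal.ofReal (g x) ^ 2 ∂(baseMeasure p)) ^ n ≤ 4)
    (hpB : p ∈ besovBall L r s B) (hpgB : (fun x => p x * g x) ∈ besovBall L r s B)
    {x₀ : Plane} (hx₀ : x₀ ∈ domain L) :
    ENNReal.ofReal (diagDist L x₀ ^ q * (|p x₀ - p x₀ * g x₀| / 128)) ≤
      minimaxRisk L M q r s B n := by
  obtain ⟨T, hT, hTK⟩ := exists_measurable_dirac (q := q) hM hK hKd hKM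
  have hTin : ∀ x ∈ K, (T x : Measure Plane) = Measure.dirac x := fun x hx => by simp [hTK, hx]
  have hTout : ∀ x ∉ K, (T x : Measure Plane) = 0 := fun x hx => by simp [hTK, hx]
  have hν := isProbabilityMeasure_baseMeasure hp1
  have hν' : IsProbabilityMeasure ((baseMeasure p).withDensity fun x => ENNReal.ofReal (g x)) :=
    ⟨by simp [hg1]⟩
  let P₀ : ProbabilityMeasure (boundedPersistence L M q) :=
    ⟨(baseMeasure p).map T, Measure.isProbabilityMeasure_map hT.aemeasurable⟩
  let P₁ : ProbabilityMeasure (boundedPersistence L M q) :=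
    ⟨((baseMeasure p).withDensity fun x => ENNReal.ofReal (g x)).map T,
      Measure.isProbabilityMeasure_map hT.aemeasurable⟩
  have hP₀ : IsIntensity L M q P₀ p := by
    have := isIntensity_map hT hTin hTout hp hp0 hpK (g := fun _ => 1) measurable_const
      (fun _ => zero_le_one) P₀ (by simp [P₀])
    simpa using this
  have hP₁ : IsIntensity L M q P₁ fun x => p x * g x :=
    isIntensity_map hT hTin hTout hp hp0 hpK hg hg0 P₁ rfl
  refine le_iInf₂ fun phat hphat => ?_
  have hd : 0 ≤ diagDist L x₀ := Metric.infDist_nonneg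
  have hθ : Measurable fun D : Fin n → Plane => phat (fun i => T (D i)) x₀ :=
    (hphat.2 x₀ hx₀).comp (by fun_prop)
  have key := two_point_lower_bound (baseMeasure p) (g := fun x => ENNReal.ofReal (g x))
    (by fun_prop) hg1 hg2 hθ (p x₀) (p x₀ * g x₀)
  rw [ENNReal.ofReal_mul (by positivity)]
  rcases le_max_iff.1 key with h | h
  · exact ((mul_le_mul_right h _).trans
      (lintegral_pi_le_risk hphat hT (baseMeasure p) P₀ rfl p hx₀)).trans
      (le_iSup_of_le P₀ <| le_iSup_of_le p <| le_iSup₂_of_le hP₀ hpB le_rfl)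
  · exact ((mul_le_mul_right h _).trans
      (lintegral_pi_le_risk hphat hT _ P₁ rfl (fun x => p x * g x) hx₀)).trans
      (le_iSup_of_le P₁ <| le_iSup_of_le _ <| le_iSup₂_of_le hP₁ hpgB le_rfl)

/-- First two moments of a mean-zero relative perturbation `1 + ε u` of the density `p`. -/
lemma lintegral_perturbation {p u : Plane → ℝ} (hp : Measurable p) (hp0 : ∀ x, 0 ≤ p x)
    (hp1 : ∫⁻ x, ENNReal.ofReal (p x) ≤ 1) {c ε : ℝ} (hε0 : 0 ≤ ε) (hε1 : ε ≤ 1)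
    (hu : Measurable u) (hu1 : ∀ x, |u x| ≤ 1) (h0 : u 0 = 0) (hpu : ∀ x, p x * u x = c * u x)
    (hmean : ∫ x, u x = 0) :
    (∀ x, 0 ≤ 1 + ε * u x) ∧ ∫⁻ x, ENNReal.ofReal (1 + ε * u x) ∂(baseMeasure p) = 1 ∧
    ∫⁻ x, ENNReal.ofReal (1 + ε * u x) ^ 2 ∂(baseMeasure p) =
      ENNReal.ofReal (1 + ε ^ 2 * (c * ∫ x, u x ^ 2)) := by
  have hν := isProbabilityMeasure_baseMeasure hp1
  have hpos : ∀ x, 0 ≤ 1 + ε * u x := fun x => by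
    have := abs_le.1 (hu1 x)
    nlinarith
  have hi : Integrable u (baseMeasure p) :=
    Integrable.of_bound hu.aestronglyMeasurable 1 (.of_forall hu1)
  have hi2 : Integrable (fun x => u x ^ 2) (baseMeasure p) :=
    Integrable.of_bound (hu.pow_const 2).aestronglyMeasurable 1 (.of_forall fun x => by
      rw [Real.norm_eq_abs, abs_pow]; exact pow_le_one₀ (abs_nonneg _) (hu1 x))
  have hm1 : ∫ x, u x ∂(baseMeasure p) = 0 := by
    rw [integral_baseMeasure hp hp0 hi h0]
    simp_rw [hpu]
    rw [integral_const_mul, hmean, mul_zero]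
  have hm2 : ∫ x, u x ^ 2 ∂(baseMeasure p) = c * ∫ x, u x ^ 2 := by
    rw [integral_baseMeasure hp hp0 hi2 (by simp [h0]), ← integral_const_mul]
    refine integral_congr_ae (.of_forall fun x => ?_)
    simp only [sq, ← mul_assoc, hpu]
  refine ⟨hpos, ?_, ?_⟩
  · have i1 : Integrable (fun x => 1 + ε * u x) (baseMeasure p) :=
      (integrable_const 1).add (hi.const_mul ε)
    rw [← ofReal_integral_eq_lintegral_ofReal i1 (.of_forall hpos),
      integral_add (integrable_const 1) (hi.const_mul ε), integral_const_mul,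
      hm1]
    simp
  · simp_rw [← ENNReal.ofReal_pow (hpos _)]
    have e : ∀ x, (1 + ε * u x) ^ 2 = 1 + 2 * ε * u x + ε ^ 2 * u x ^ 2 := fun x => by ring
    simp_rw [e]
    have i1 : Integrable (fun x => 1 + 2 * ε * u x) (baseMeasure p) :=
      (integrable_const 1).add (hi.const_mul (2 * ε))
    have i2 := hi2.const_mul (ε ^ 2)
    have i3 : Integrable (fun x => 1 + 2 * ε * u x + ε ^ 2 * u x ^ 2) (baseMeasure p) := i1.add i2
    rw [← ofReal_integral_eq_lintegral_ofReal i3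
      (.of_forall fun x => (sq_nonneg _).trans_eq (e x)),
      integral_add i1 i2, integral_add (integrable_const 1) (hi.const_mul _),
      integral_const_mul, integral_const_mul, hm1, hm2]
    simp

end Model

/-! ### Distance to the diagonal -/

section Geometry

lemma diagDist_le {L : ℝ} {x : Plane} (hx : x ∈ domain L) : diagDist L x ≤ x 1 - x 0 := by
  have hmem : (!₂[x 0, x 0] : Plane) ∈ diagonal L :=
    ⟨rfl, hx.1.le, hx.2.1.le.trans hx.2.2⟩
  refine (Metric.infDist_le_dist_of_mem hmem).trans ?_
  rw [EuclideanSpace.dist_eq, Fin.sum_univ_two]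
  simp [Real.sqrt_sq_eq_abs, Real.dist_eq, abs_of_pos (sub_pos.2 hx.2.1)]

lemma abs_coord_sub_le_dist (x y : Plane) (i : Fin 2) : |x i - y i| ≤ dist x y := by
  rw [dist_eq_norm]
  simpa using PiLp.norm_apply_le (x - y) i

/-- For `y` on the diagonal, `x 1 - x 0` is the sum of the coordinate gaps `x 1 - y 1` and `y 0 - x
0`, each at most `dist x y`. -/
lemma le_diagDist {L : ℝ} (hL : 0 ≤ L) (x : Plane) : (x 1 - x 0) / 2 ≤ diagDist L x := by
  refine (Metric.le_infDist (s := diagonal L) ⟨0, rfl, le_rfl, hL⟩).2 fun y hy => ?_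
  have h0 := abs_le.1 (abs_coord_sub_le_dist x y 0)
  have h1 := abs_le.1 (abs_coord_sub_le_dist x y 1)
  have := hy.1
  linarith

/-- Near the diagonal there is a ball in `Ω` whose points have small persistence. -/
lemma exists_ball_subset_domain {L M q : ℝ} (hL : 0 < L) (hM : 0 < M) (hq : 0 < q) :
    ∃ (x₀ : Plane) (ρ : ℝ), 0 < ρ ∧ 0 < diagDist L x₀ ∧ x₀ ∈ domain L ∧
      ∀ x ∈ Metric.ball x₀ (2 * ρ), x ∈ domain L ∧ diagDist L x ^ q < M := by
  set η : ℝ := min (L / 4) (M ^ q⁻¹ / 2) with hη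
  have hη0 : 0 < η := by positivity
  have hηL : η ≤ L / 4 := min_le_left _ _
  have hηM : 2 * η ≤ M ^ q⁻¹ := by
    have : η ≤ M ^ q⁻¹ / 2 := min_le_right _ _
    linarith
  -- Within `η / 4` of this point the persistence `x 1 - x 0` stays between `η / 2` and `3 * η / 2`,
  -- below `M ^ q⁻¹`.
  let x₀ : Plane := !₂[L / 2, L / 2 + η]
  have hball : ∀ x ∈ Metric.ball x₀ (2 * (η / 8)), x ∈ domain L ∧ diagDist L x ^ q < M := by
    intro x hx
    have hx' : dist x x₀ < 2 * (η / 8) := hx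
    have h0 := abs_le.1 (abs_coord_sub_le_dist x x₀ 0)
    have h1 := abs_le.1 (abs_coord_sub_le_dist x x₀ 1)
    have e0 : x₀ 0 = L / 2 := rfl
    have e1 : x₀ 1 = L / 2 + η := rfl
    rw [e0] at h0
    rw [e1] at h1
    have hd : x ∈ domain L := ⟨by linarith, by linarith, by linarith⟩
    refine ⟨hd, ?_⟩
    have hlt : diagDist L x < M ^ q⁻¹ := by
      have := diagDist_le hd
      linarith
    calc diagDist L x ^ q < (M ^ q⁻¹) ^ q := Real.rpow_lt_rpow Metric.infDist_nonneg hlt hq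
      _ = M := Real.rpow_inv_rpow hM.le hq.ne'
  refine ⟨x₀, η / 8, by positivity, ?_, (hball x₀ (Metric.mem_ball_self (by positivity))).1, hball⟩
  refine lt_of_lt_of_le ?_ (le_diagDist hL.le x₀)
  have : x₀ 1 - x₀ 0 = η := add_sub_cancel_left _ _
  linarith

end Geometry

/-! ### The perturbation profile and scaling -/

/-- A bump minus a translate of itself has mean zero; the shift, of length 2, equals the outer
radius, so the translate vanishes at 0. -/
lemma exists_smooth_mean_zero :
    ∃ Ψ : Plane → ℝ, (∀ r : ℕ, ContDiff ℝ r Ψ) ∧ HasCompactSupport Ψ ∧ Ψ 0 = 1 ∧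
      ∫ y, Ψ y = 0 ∧ (∀ y, |Ψ y| ≤ 1) ∧ ∀ y, 4 ≤ ‖y‖ → Ψ y = 0 := by
  let b : ContDiffBump (0 : Plane) := ⟨1, 2, one_pos, one_lt_two⟩
  let a : Plane := EuclideanSpace.single 0 2
  have ha : ‖a‖ = 2 := by simp [a]
  have hzero : ∀ y, 4 ≤ ‖y‖ → b y - b (y - a) = 0 := by
    intro y hy
    have h1 : b y = 0 := b.zero_of_le_dist (by
      rw [dist_zero_right]; exact le_trans (by norm_num) hy)
    have h2 : b (y - a) = 0 := b.zero_of_le_dist (by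
      rw [dist_zero_right]
      have := norm_sub_norm_le y a
      change (2 : ℝ) ≤ _
      linarith)
    rw [h1, h2, sub_zero]
  refine ⟨fun y => b y - b (y - a), fun r => ?_, ?_, ?_, ?_, fun y => ?_, hzero⟩
  · exact b.contDiff.sub (b.contDiff.comp (contDiff_id.sub contDiff_const))
  · refine HasCompactSupport.intro (isCompact_closedBall 0 4) fun y hy => hzero y ?_
    rw [mem_closedBall_zero_iff, not_le] at hy
    exact hy.le
  · have h1 : b 0 = 1 := b.one_of_mem_closedBall (Metric.mem_closedBall_self zero_le_one)
    have h2 : b (0 - a) = 0 := b.zero_of_le_dist (by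
      rw [dist_zero_right, zero_sub, norm_neg, ha])
    change b 0 - b (0 - a) = 1
    rw [h1, h2, sub_zero]
  · have hi : Integrable b := b.continuous.integrable_of_hasCompactSupport b.hasCompactSupport
    rw [integral_sub hi (hi.comp_sub_right a), integral_sub_right_eq_self, sub_self]
  · have h1 := b.nonneg (x := y)
    have h2 := b.le_one (x := y)
    have h3 := b.nonneg (x := y - a)
    have h4 := b.le_one (x := y - a)
    exact abs_le.2 ⟨by linarith, by linarith⟩

lemma integral_comp_inv_smul_sub (f : Plane → ℝ) {h : ℝ} (hh : 0 ≤ h) (x₀ : Plane) :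
    ∫ x, f (h⁻¹ • (x - x₀)) = h ^ 2 * ∫ y, f y := by
  rw [integral_sub_right_eq_self (fun x => f (h⁻¹ • x)),
    Measure.integral_comp_inv_smul_of_nonneg _ _ hh]
  simp

lemma one_add_inv_pow_le_four (n : ℕ) : (1 + (n : ℝ)⁻¹) ^ n ≤ 4 := by
  rcases Nat.eq_zero_or_pos n with rfl | hn
  · norm_num
  calc (1 + (n : ℝ)⁻¹) ^ n ≤ Real.exp (n : ℝ)⁻¹ ^ n := by
        gcongr
        rw [add_comm]; exact Real.add_one_le_exp _
    _ = Real.exp 1 := by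
        rw [← Real.exp_nat_mul, mul_inv_cancel₀ (by positivity)]
    _ ≤ 4 := by linarith [Real.exp_one_lt_d9]

end PersistenceMinimax

/-! ### The lower bound -/

open PersistenceMinimax in
theorem mainTheorem11 (L M q s B : ℝ) (hL : 0 < L) (hM : 0 < M) (hq : 0 < q) (hs : 0 < s)
    (hB : 0 < B) (r : ℕ) (hr : s < (r : ℝ)) :
    ∃ C : ℝ, 0 < C ∧ ∀ n : ℕ, 1 ≤ n →
      ENNReal.ofReal (C * (n : ℝ) ^ (-(s / (2 * (s + 1))))) ≤
        PersistenceMinimax.minimaxRisk L M q r s B n := by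
  obtain ⟨x₀, ρ, hρ, hd, hx₀, hball⟩ := exists_ball_subset_domain hL hM hq
  obtain ⟨Ψ, hΨ, hΨc, hΨ0, hΨint, hΨ1, hΨ4⟩ := exists_smooth_mean_zero
  let b : ContDiffBump x₀ := ⟨ρ, 2 * ρ, hρ, by linarith⟩
  obtain ⟨K₁, hK₁, hbK⟩ := exists_norm_fwdDiff_iter_le_rpow hs hr (b.contDiff (n := r))
    b.hasCompactSupport
  obtain ⟨K₂, hK₂, hΨK⟩ := exists_norm_fwdDiff_iter_le_rpow hs hr (hΨ r) hΨc
  have hΨm : Measurable Ψ := (hΨ r).continuous.measurable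
  have hb1 : ∀ x, |b x| ≤ 1 := fun x => by rw [abs_of_nonneg b.nonneg]; exact b.le_one
  have hbout : ∀ x ∉ Metric.ball x₀ (2 * ρ), b x = 0 := fun x hx =>
    b.zero_of_le_dist (not_lt.1 hx)
  have hV : 0 ≤ ∫ x, b x := integral_nonneg fun x => b.nonneg
  set V : ℝ := ∫ x, b x
  -- the base density `c * b`
  obtain ⟨c, hc, hcV, hcB⟩ : ∃ c : ℝ, 0 < c ∧ c * V ≤ 1 ∧ c * (1 + K₁) ≤ B / 2 := by
    refine ⟨min (1 / (1 + V)) (B / 2 / (1 + K₁)), by positivity, ?_, ?_⟩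
    · calc _ ≤ 1 / (1 + V) * V := by gcongr; exact min_le_left _ _
        _ ≤ 1 := by rw [one_div, inv_mul_le_one₀ (by positivity)]; linarith
    · calc _ ≤ B / 2 / (1 + K₁) * (1 + K₁) := by gcongr; exact min_le_right _ _
        _ = B / 2 := div_mul_cancel₀ _ (by positivity)
  have hp : Measurable fun x => c * b x := b.continuous.measurable.const_mul c
  have hp0 : ∀ x, 0 ≤ c * b x := fun x => mul_nonneg hc.le b.nonneg
  have hp1 : ∫⁻ x, ENNReal.ofReal (c * b x) ≤ 1 := by
    rw [← ofReal_integral_eq_lintegral_ofReal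
      ((b.continuous.integrable_of_hasCompactSupport b.hasCompactSupport).const_mul c)
      (.of_forall hp0), integral_const_mul]
    exact ENNReal.ofReal_le_one.2 hcV
  have hpdiff : ∀ v x, |(fwdDiff v)^[r] (fun x => c * b x) x| ≤ c * K₁ * ‖v‖ ^ s := fun v x => by
    have := fwdDiff_iter_const_smul v c b r
    rw [show (fun x => c * b x) = c • ⇑b from rfl, this, Pi.smul_apply, smul_eq_mul, abs_mul,
      abs_of_pos hc, mul_assoc]
    gcongr
    exact hbK v x
  have hpb : ∀ x, |c * b x| ≤ c := fun x => by
    rw [abs_mul, abs_of_pos hc]; exact mul_le_of_le_one_right hc.le (hb1 x)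
  have hpB : (fun x => c * b x) ∈ besovBall L r s B :=
    mem_besovBall_of_bounds hs hc.le (by positivity) hpb hpdiff (by linarith)
  -- the scale and the size of the perturbation
  have hJ : 0 ≤ ∫ y, Ψ y ^ 2 := integral_nonneg fun y => sq_nonneg _
  set J : ℝ := ∫ y, Ψ y ^ 2
  set h₀ : ℝ := ρ / 4
  have hh₀ : 0 < h₀ := by positivity
  -- The three upper bounds give, in turn, `ε ≤ 1` (a nonnegative density), the half of the Besov
  -- radius left by `c * b`, and a second moment excess of at most `1 / n`.
  obtain ⟨γ, hγ, hγ1, hγB, hγJ⟩ : ∃ γ : ℝ, 0 < γ ∧ γ * h₀ ^ s ≤ 1 ∧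
      c * γ * (h₀ ^ s + K₂) ≤ B / 2 ∧ γ ^ 2 * ((h₀ ^ s) ^ 2 * h₀ ^ 2 * (c * J)) ≤ 1 := by
    set X : ℝ := (h₀ ^ s) ^ 2 * h₀ ^ 2 * (c * J)
    set Y : ℝ := c * (h₀ ^ s + K₂) * (2 / B)
    have hX : 0 ≤ X := by positivity
    have hY : 0 ≤ Y := by positivity
    have hZ : 0 ≤ h₀ ^ s := by positivity
    set D : ℝ := 1 + h₀ ^ s + Y + X
    have hD : 0 < D := by positivity
    have hle : ∀ t, t ≤ D → D⁻¹ * t ≤ 1 := fun t ht => (inv_mul_le_one₀ hD).2 ht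
    have h1 : D⁻¹ ≤ 1 := by simpa using hle 1 (by simp only [D]; linarith)
    refine ⟨D⁻¹, by positivity, hle _ (by simp only [D]; linarith), ?_, ?_⟩
    · have := hle Y (by simp only [D]; linarith)
      calc _ = D⁻¹ * Y * (B / 2) := by simp only [Y]; field_simp
        _ ≤ 1 * (B / 2) := by gcongr
        _ = B / 2 := one_mul _
    · calc _ ≤ D⁻¹ * X := by
            gcongr
            exact pow_le_of_le_one (by positivity) h1 two_ne_zero
        _ ≤ 1 := hle X (by simp only [D]; linarith)
  refine ⟨diagDist L x₀ ^ q * (c * (γ * h₀ ^ s) / 128), by positivity, fun n hn => ?_⟩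
  have hn0 : (0 : ℝ) < n := by exact_mod_cast hn
  have hn1 : (1 : ℝ) ≤ n := by exact_mod_cast hn
  set w : ℝ := (n : ℝ) ^ (-(1 / (2 * (s + 1))))
  have hw : 0 < w := by positivity
  have hw1 : w ≤ 1 := Real.rpow_le_one_of_one_le_of_nonpos hn1
    (by rw [neg_nonpos]; positivity)
  have hws : w ^ s = (n : ℝ) ^ (-(s / (2 * (s + 1)))) := by
    rw [← Real.rpow_mul hn0.le]; congr 1; ring
  have hws1 : w ^ s ≤ 1 := Real.rpow_le_one hw.le hw1 hs.le
  -- This identity fixes the exponent of `w`: squared amplitude times area must be `1 / n`.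
  have hwn : (w ^ s) ^ 2 * w ^ 2 = (n : ℝ)⁻¹ := by
    rw [← mul_pow, ← Real.rpow_add_one hw.ne', ← Real.rpow_mul hn0.le,
      ← Real.rpow_mul_natCast hn0.le, ← Real.rpow_neg_one]
    congr 1
    push_cast
    field_simp
  set h : ℝ := h₀ * w
  have hh : 0 < h := by positivity
  have hhs : h ^ s = h₀ ^ s * w ^ s := Real.mul_rpow hh₀.le hw.le
  have hhs1 : h ^ s ≤ h₀ ^ s := by
    rw [hhs]; exact mul_le_of_le_one_right (by positivity) hws1
  set ε : ℝ := γ * h ^ s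
  have hε : 0 < ε := by positivity
  have hε1 : ε ≤ 1 := (mul_le_mul_of_nonneg_left hhs1 hγ.le).trans hγ1
  let u : Plane → ℝ := fun x => Ψ (h⁻¹ • (x - x₀))
  have hu : Measurable u := by fun_prop
  have hu1 : ∀ x, |u x| ≤ 1 := fun x => hΨ1 _
  have hufar : ∀ x, ρ ≤ dist x x₀ → u x = 0 := fun x hx => by
    refine hΨ4 _ ?_
    rw [norm_smul, norm_inv, Real.norm_of_nonneg hh.le, ← dist_eq_norm, le_inv_mul_iff₀ hh]
    have : h ≤ h₀ := mul_le_of_le_one_right hh₀.le hw1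
    have : h₀ * 4 = ρ := div_mul_cancel₀ _ (by norm_num)
    linarith
  have hu0 : u 0 = 0 := hufar 0 <| not_lt.1 fun hlt =>
    zero_notMem_domain L (hball 0 (lt_trans hlt (by linarith))).1
  have hpu : ∀ x, c * b x * u x = c * u x := fun x => by
    rcases le_total ρ (dist x x₀) with hx | hx
    · simp [hufar x hx]
    · rw [b.one_of_mem_closedBall hx, mul_one]
  have humean : ∫ x, u x = 0 := by
    rw [integral_comp_inv_smul_sub Ψ hh.le, hΨint, mul_zero]
  have husq : ∫ x, u x ^ 2 = h ^ 2 * J := integral_comp_inv_smul_sub (fun y => Ψ y ^ 2) hh.le x₀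
  obtain ⟨hg0, hg1, hg2⟩ := lintegral_perturbation hp hp0 hp1 hε.le hε1 hu hu1 hu0 hpu humean
  have hsecond : ε ^ 2 * (c * ∫ x, u x ^ 2) ≤ (n : ℝ)⁻¹ := by
    calc _ = γ ^ 2 * ((h₀ ^ s) ^ 2 * h₀ ^ 2 * (c * J)) * ((w ^ s) ^ 2 * w ^ 2) := by
          rw [husq]; simp only [ε, hhs, h]; ring
      _ ≤ 1 * (w ^ s) ^ 2 * w ^ 2 := by rw [mul_assoc 1]; gcongr
      _ = _ := by rw [one_mul, hwn]
  have hpg : (fun x => c * b x * (1 + ε * u x)) = fun x => c * b x + c * ε * u x := by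
    ext x
    linear_combination ε * hpu x
  -- Dilation costs a factor `h ^ (-s)`, which `ε = γ * h ^ s` cancels, so the Besov bound does not
  -- depend on `n`.
  have hudiff : ∀ v x, |(fwdDiff v)^[r] u x| ≤ K₂ / h ^ s * ‖v‖ ^ s := fun v x => by
    rw [fwdDiff_iter_comp_smul_sub Ψ h⁻¹ x₀ v r x]
    refine (hΨK _ _).trans_eq ?_
    rw [norm_smul, norm_inv, Real.norm_of_nonneg hh.le,
      Real.mul_rpow (by positivity) (norm_nonneg v), Real.inv_rpow hh.le]
    ring
  have hpgB : (fun x => c * b x * (1 + ε * u x)) ∈ besovBall L r s B := by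
    rw [hpg]
    refine mem_besovBall_of_bounds (A := c + c * ε) (K := c * K₁ + c * γ * K₂) hs (by positivity)
      (by positivity) (fun x => ?_) (fun v x => ?_) ?_
    · refine (abs_add_le _ _).trans (add_le_add (hpb x) ?_)
      rw [abs_mul, abs_of_pos (by positivity)]
      exact mul_le_of_le_one_right (by positivity) (hu1 x)
    · rw [show (fun x => c * b x + c * ε * u x) = (fun x => c * b x) + (c * ε) • u from rfl,
        fwdDiff_iter_add, fwdDiff_iter_const_smul, add_mul]
      refine (abs_add_le _ _).trans (add_le_add (hpdiff v x) ?_)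
      rw [Pi.smul_apply, smul_eq_mul, abs_mul, abs_of_pos (by positivity)]
      calc _ ≤ c * ε * (K₂ / h ^ s * ‖v‖ ^ s) := by gcongr; exact hudiff v x
        _ = _ := by simp only [ε]; field_simp
    · have : c * ε ≤ c * γ * h₀ ^ s := by
        rw [mul_assoc c γ]
        exact mul_le_mul_of_nonneg_left (mul_le_mul_of_nonneg_left hhs1 hγ.le) hc.le
      linarith
  have hx₀b : b x₀ = 1 := b.one_of_mem_closedBall (Metric.mem_closedBall_self hρ.le)
  have hx₀u : u x₀ = 1 := by simp only [u, sub_self, smul_zero, hΨ0]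
  refine le_trans (le_of_eq ?_) (two_point_le_minimaxRisk hM Metric.isOpen_ball.measurableSet
    (fun x hx => (hball x hx).1) (fun x hx => (hball x hx).2) hp hp0
    (fun x hx => by rw [hbout x hx, mul_zero]) hp1
    (by fun_prop : Measurable fun x => 1 + ε * u x) hg0 hg1 ?_ hpB hpgB hx₀)
  · rw [hx₀b, hx₀u, ← hws]
    congr 1
    rw [show c * 1 - c * 1 * (1 + ε * 1) = -(c * ε) by ring, abs_neg, abs_of_pos (by positivity)]
    simp only [ε, hhs]
    ring
  · rw [hg2, ← ENNReal.ofReal_pow (by positivity)]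
    refine ENNReal.ofReal_le_of_le_toReal ?_
    refine (pow_le_pow_left₀ (by positivity) ?_ n).trans (one_add_inv_pow_le_four n)
    linarith
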